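/- Consider Gaussian best arm identification with $k \ge 2$ arms and known variances $\sigma_1^2,\dots,\sigma_k^2 > 0$. An instance is a mean vector $\mu \in \mathbb{R}^k$. In each round $t = 1, 2, \dots$ the forecaster pulls an arm $A_t \in [k]$ and observes a reward $X_t$ which, given the past and $A_t$, has law $N(\mu_{A_t}, \sigma_{A_t}^2)$. An algorithm is a triple $\pi = ((A_t)_{t\ge1}, \tau, J)$. The forecaster may use an internal random seed $U$, with values in an arbitrary probability space and independent of the rewards given the instance; a deterministic seed gives the non-randomized algorithms. With $\mathcal{F}_t = \sigma(U, A_1, X_1, \dots, A_t, X_t)$, each $A_t$ is $\mathcal{F}_{t-1}$-measurable, the number $\tau \in \{0, 1, 2, \dots\} \cup \{\infty\}$ of rounds played is a stopping time with respect to $(\mathcal{F}_t)_{t\ge0}$, and the recommendation $J \in [k]$ is $\mathcal{F}_\tau$-measurable. Write $\mathbb{P}_\mu$ and $\mathbb{E}_\mu$ for probability and expectation on the instance $\mu$. The algorithm is called frequentist $\delta$-correct if $\mathbb{P}_\mu(J \ne i^*(\mu)) \le \delta$ for every $\mu \in \mathbb{R}^k$ that has a unique best arm $i^*(\mu) = \operatorname{argmax}_{i}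 \mu_i$. Theorem. Let $0 < \delta < 1/2$, let $m \in \mathbb{R}^k$ and $\xi_1, \dots, \xi_k > 0$, and let $H = \bigotimes_{i=1}^k N(m_i, \xi_i^2)$ be the prior under which the means $\mu_i \sim N(m_i, \xi_i^2)$ are independent. Then every frequentist $\delta$-correct algorithm satisfies $$\mathbb{E}_{\mu \sim H}[\tau] = \int_{\mathbb{R}^k} \mathbb{E}_\mu[\tau] \, H(d\mu) = +\infty .$$ -/

import Mathlib

open MeasureTheory ProbabilityTheory
open scoped NNReal ENNReal

namespace GaussianBandit

/-- Sample space of a `k`-armed bandit. A point `(u, x)` consists of the internal random seed `u`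
of the forecaster and of the table of rewards: `x t i` is the reward that arm `i` yields if it is
pulled in round `t + 1`. Only the entry of the pulled arm is revealed to the forecaster, see
`history`. -/
abbrev SampleSpace (k : ℕ) (S : Type*) : Type _ := S × (ℕ → Fin k → ℝ)

/-- The law `ℙ_μ` on the sample space when the means of the arms are `μ` and their standard
deviations are `σ`: the seed has law `ρ`, the reward of arm `i` in each round has law
`N(μ i, σ i ^ 2)`, and all of these are independent. -/
noncomputable def banditLaw {k : ℕ} {S : Type*} [MeasurableSpace S] (ρ : Measure S)
    (σ : Fin k → ℝ≥0) (μ : Fin k → ℝ) : Measure (SampleSpace k S) :=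
  ρ.prod (Measure.infinitePi fun _ : ℕ =>
    Measure.pi fun i : Fin k => gaussianReal (μ i) (σ i ^ 2))

/-- The reward observed in round `t + 1` when the arms are pulled according to `arm`. -/
def reward {k : ℕ} {S : Type*} (arm : ℕ → SampleSpace k S → Fin k) (t : ℕ)
    (ω : SampleSpace k S) : ℝ :=
  ω.2 t (arm t ω)

/-- The `σ`-algebra `ℱ_t = σ(U, A_1, X_1, …, A_t, X_t)` generated by the seed and by the arms and
the observed rewards of the first `t` rounds. -/
@[reducible] def history {k : ℕ} {S : Type*} [MeasurableSpace S] (arm : ℕ → SampleSpace k S → Fin k)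
    (t : ℕ) : MeasurableSpace (SampleSpace k S) :=
  MeasurableSpace.comap Prod.fst inferInstance ⊔
    ⨆ s : ℕ, ⨆ _ : s < t,
      MeasurableSpace.comap (fun ω => (arm s ω, reward arm s ω)) inferInstance

theorem history_mono {k : ℕ} {S : Type*} [MeasurableSpace S]
    (arm : ℕ → SampleSpace k S → Fin k) : Monotone (history arm) := by
  intro a b hab
  refine sup_le_sup_left (iSup_mono fun s => ?_) _
  exact iSup_le fun hs => le_iSup_of_le (hs.trans_le hab) le_rfl

theorem history_le {k : ℕ} {S : Type*} [MeasurableSpace S]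
    (arm : ℕ → SampleSpace k S → Fin k) (h : ∀ t, Measurable[history arm t] (arm t)) (t : ℕ) :
    history arm t ≤ (inferInstance : MeasurableSpace (SampleSpace k S)) := by
  induction t using Nat.strong_induction_on with
  | _ t ih =>
    refine sup_le measurable_fst.comap_le (iSup_le fun s => iSup_le fun hs => ?_)
    have hA : Measurable (arm s) := (h s).mono (ih s hs) le_rfl
    have hX : Measurable (reward arm s) := by
      have hev : Measurable fun p : Fin k × (Fin k → ℝ) => p.2 p.1 :=
        measurable_from_prod_countable_right fun i => measurable_pi_apply i
      exact hev.comp (hA.prodMk ((measurable_pi_apply s).comp measurable_snd))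
    exact (hA.prodMk hX).comap_le

/-- The filtration `(ℱ_t)_t` of a sampling rule whose choice in round `t + 1` is
`ℱ_t`-measurable. -/
def historyFiltration {k : ℕ} {S : Type*} [MeasurableSpace S]
    (arm : ℕ → SampleSpace k S → Fin k) (h : ∀ t, Measurable[history arm t] (arm t)) :
    Filtration ℕ (inferInstance : MeasurableSpace (SampleSpace k S)) where
  seq := history arm
  mono' := history_mono arm
  le' := history_le arm h

/-- An algorithm `((A_t)_t, τ, J)` of the forecaster. -/
structure Algorithm (k : ℕ) (S : Type*) [MeasurableSpace S] where
  /-- Sampling rule: `arm t` is the arm `A_{t + 1}` pulled in round `t + 1`. -/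
  arm : ℕ → SampleSpace k S → Fin k
  /-- The arm pulled in round `t + 1` is determined by the observations of the first `t` rounds. -/
  measurable_arm : ∀ t, Measurable[history arm t] (arm t)
  /-- Stopping rule: the number of rounds that are played, `⊤` if the algorithm never stops. -/
  τ : SampleSpace k S → ℕ∞
  isStoppingTime : IsStoppingTime (historyFiltration arm measurable_arm) τ
  /-- Decision rule: the recommended arm. -/
  J : SampleSpace k S → Fin k
  measurable_J : Measurable[isStoppingTime.measurableSpace] J

/-- Arm `i` is the unique best arm of the instance `μ`. -/
def IsUniqueBest {k : ℕ} (μ : Fin k → ℝ) (i : Fin k) : Prop :=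
  ∀ j, j ≠ i → μ j < μ i

/-- Frequentist `δ`-correctness: on each instance with a unique best arm, the recommended arm is
wrong with probability at most `δ`. -/
def Algorithm.IsDeltaCorrect {k : ℕ} {S : Type*} [MeasurableSpace S] (π : Algorithm k S)
    (ρ : Measure S) (σ : Fin k → ℝ≥0) (δ : ℝ) : Prop :=
  ∀ (μ : Fin k → ℝ) (i : Fin k), IsUniqueBest μ i →
    banditLaw ρ σ μ {ω | π.J ω ≠ i} ≤ ENNReal.ofReal δ

/-- `𝔼_μ[τ]`, the expected stopping time on the instance `μ`. -/
noncomputable def Algorithm.expectedTime {k : ℕ} {S : Type*} [MeasurableSpace S]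
    (π : Algorithm k S) (ρ : Measure S) (σ : Fin k → ℝ≥0) (μ : Fin k → ℝ) : ℝ≥0∞ :=
  ∫⁻ ω, (π.τ ω : ℝ≥0∞) ∂(banditLaw ρ σ μ)

/-- The Gaussian prior on the means: `μ i ∼ N(m i, ξ i ^ 2)`, independently over the arms. -/
noncomputable def gaussianPrior {k : ℕ} (m : Fin k → ℝ) (ξ : Fin k → ℝ≥0) :
    Measure (Fin k → ℝ) :=
  Measure.pi fun i => gaussianReal (m i) (ξ i ^ 2)

/-- `𝔼_{μ ∼ H}[τ] = 𝔼_{μ ∼ H}[𝔼_μ[τ]]`, the Bayesian expected stopping time. -/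
noncomputable def Algorithm.bayesExpectedTime {k : ℕ} {S : Type*} [MeasurableSpace S]
    (π : Algorithm k S) (ρ : Measure S) (σ : Fin k → ℝ≥0) (H : Measure (Fin k → ℝ)) : ℝ≥0∞ :=
  ∫⁻ μ, π.expectedTime ρ σ μ ∂H

end GaussianBandit

/-!
The proof bounds `𝔼_μ[τ]` below by a constant times the inverse of the gap between the best arm of
`μ` and a fixed other one, and observes that the inverse of the gap is not integrable under a
Gaussian prior.

Lower bound (`Algorithm.div_gap_le_expectedTime`). Let `i` be the best arm of `μ`, `j` another arm,
and `Δ = μ i - μ j`, supposed small. Reflecting `μ j` about `μ i` gives an instance with best arm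
`j`, on which `δ`-correctness makes the event `{J = i, τ ≤ n}` have probability at most `δ`. This
event is decided by the seed and by the rewards of the first `n` rounds. Whatever the sampling
rule, it is an event about `n` independent copies of a row of Gaussian rewards, and the two laws of
a row are at total variation distance `O(Δ)`. By subadditivity of the total variation over
products, the event has probability at most `δ + O(n Δ)` under `μ`, so that `τ > n` with probability
at least `1 - 2 δ - O(n Δ)`. Since `δ < 1 / 2`, Markov's inequality with `n` of order `1 / Δ` gives
`𝔼_μ[τ] ≥ c / Δ`. A bound of order `1 / Δ ^ 2` also holds, but this weaker one suffices and needs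
neither likelihood ratios of adaptive samples nor information-theoretic inequalities.

Divergence (`lintegral_inv_gap_gaussianPrior`). Fix the means of all arms but `i` so that `j` is
the best of them, which has positive prior probability. The density of `μ i` is bounded below near
`μ j`, so the integral of `1 / (μ i - μ j)` over `μ i` slightly larger than `μ j` is infinite.
-/

namespace GaussianBandit

/-! ### One-sided total variation bounds -/

/-- The measure `μ` exceeds the measure `ν` by at most `d` on every measurable set. For
probability measures this says that their total variation distance is at most `d`. -/
def ExceedsByAtMost {X : Type*} [MeasurableSpace X] (μ ν : Measure X) (d : ℝ≥0∞) : Prop :=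
  ∀ A, MeasurableSet A → μ A ≤ ν A + d

namespace ExceedsByAtMost

variable {X Y : Type*} [MeasurableSpace X] [MeasurableSpace Y]

theorem refl (μ : Measure X) (d : ℝ≥0∞) : ExceedsByAtMost μ μ d :=
  fun _ _ => le_self_add

theorem of_map {μ ν : Measure X} {d : ℝ≥0∞} {f : X → Y} (hf : Measurable f)
    (h : ExceedsByAtMost (μ.map f) (ν.map f) d) {A : Set X}
    (hA : MeasurableSet[MeasurableSpace.comap f inferInstance] A) : μ A ≤ ν A + d := by
  obtain ⟨B, hB, rfl⟩ := hA
  have := h B hB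
  rwa [Measure.map_apply hf hB, Measure.map_apply hf hB] at this

theorem map {μ ν : Measure X} {d : ℝ≥0∞} (h : ExceedsByAtMost μ ν d) {f : X → Y}
    (hf : Measurable f) : ExceedsByAtMost (μ.map f) (ν.map f) d := by
  intro B hB
  rw [Measure.map_apply hf hB, Measure.map_apply hf hB]
  exact h _ (hf hB)

theorem prod {μ μ' : Measure X} {ν ν' : Measure Y} [IsProbabilityMeasure μ] [SFinite μ']
    [IsProbabilityMeasure ν'] [SFinite ν] {a b : ℝ≥0∞}
    (hμ : ExceedsByAtMost μ μ' a) (hν : ExceedsByAtMost ν ν' b) :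
    ExceedsByAtMost (μ.prod ν) (μ'.prod ν') (a + b) := by
  intro A hA
  calc μ.prod ν A = ∫⁻ x, ν (Prod.mk x ⁻¹' A) ∂μ := Measure.prod_apply hA
    _ ≤ ∫⁻ x, (ν' (Prod.mk x ⁻¹' A) + b) ∂μ :=
        lintegral_mono fun x => hν _ (measurable_prodMk_left hA)
    _ = μ.prod ν' A + b := by
        rw [lintegral_add_right _ measurable_const, Measure.prod_apply hA]; simp
    _ = ∫⁻ y, μ ((fun x => (x, y)) ⁻¹' A) ∂ν' + b := by rw [Measure.prod_apply_symm hA]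
    _ ≤ ∫⁻ y, (μ' ((fun x => (x, y)) ⁻¹' A) + a) ∂ν' + b := by
        gcongr with y
        exact hμ _ (measurable_prodMk_right hA)
    _ = μ'.prod ν' A + (a + b) := by
        rw [lintegral_add_right _ measurable_const, Measure.prod_apply_symm hA]
        simp [add_assoc]

/-- Total variation is subadditive over the factors of a finite product. -/
theorem pi {n : ℕ} {μ ν : Fin n → Measure X} [∀ i, IsProbabilityMeasure (μ i)]
    [∀ i, IsProbabilityMeasure (ν i)] {d : Fin n → ℝ≥0∞}
    (h : ∀ i, ExceedsByAtMost (μ i) (ν i) (d i)) :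
    ExceedsByAtMost (Measure.pi μ) (Measure.pi ν) (∑ i, d i) := by
  induction n with
  | zero =>
    rw [Measure.pi_of_empty μ, Measure.pi_of_empty ν]
    exact refl _ _
  | succ n ih =>
    rw [← ((measurePreserving_piFinSuccAbove μ 0).symm _).map_eq,
      ← ((measurePreserving_piFinSuccAbove ν 0).symm _).map_eq, Fin.sum_univ_succ]
    exact ((h 0).prod (ih fun i => h i.succ)).map (MeasurableEquiv.measurable _)

end ExceedsByAtMost

/-! ### Gaussian laws with nearby means -/

/-- Convexity of the exponential, applied to the likelihood ratio of two Gaussians, bounds the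
difference of their densities by a multiple of the distance of their means. -/
theorem gaussianPDFReal_le_add (a b : ℝ) {v : ℝ≥0} (hv : v ≠ 0) (hab : |a - b| ≤ 1) (x : ℝ) :
    gaussianPDFReal a v x ≤ gaussianPDFReal b v x +
      gaussianPDFReal a v x * (|a - b| * ((2 + (x - a) ^ 2) / v)) := by
  have hv' : (0 : ℝ) < v := by positivity
  set u : ℝ := (x - a) ^ 2 / (2 * v) - (x - b) ^ 2 / (2 * v) with hu
  have hratio : gaussianPDFReal b v x = gaussianPDFReal a v x * Real.exp u := by
    simp only [gaussianPDFReal, mul_assoc, ← Real.exp_add]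
    congr 2
    rw [hu]; ring
  have hlow : -(|a - b| * ((2 + (x - a) ^ 2) / v)) ≤ u := by
    have hu' : u = -((a - b) * (2 * (x - a)) + (a - b) ^ 2) / (2 * v) := by
      rw [hu]; field_simp; ring
    have hy : |x - a| ≤ 1 + (x - a) ^ 2 := by
      rw [abs_le]; constructor <;> nlinarith [sq_nonneg (x - a + 1), sq_nonneg (x - a - 1)]
    have h1 : (a - b) * (2 * (x - a)) ≤ |a - b| * (2 * |x - a|) := by
      calc _ ≤ |(a - b) * (2 * (x - a))| := le_abs_self _
        _ = _ := by rw [abs_mul, abs_mul, abs_two]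
    have h2 : (a - b) ^ 2 ≤ |a - b| := by
      rw [← sq_abs]; nlinarith [abs_nonneg (a - b)]
    have h3 : |a - b| * |x - a| ≤ |a - b| * (1 + (x - a) ^ 2) := by gcongr
    rw [hu', neg_div, neg_le_neg_iff, ← mul_div_assoc, div_le_div_iff₀ (by positivity) hv']
    nlinarith [abs_nonneg (a - b)]
  have hexp := Real.add_one_le_exp u
  have hpos := gaussianPDFReal_nonneg a v x
  rw [hratio]
  nlinarith

theorem integral_sq_sub_gaussianReal (a : ℝ) (v : ℝ≥0) :
    ∫ x, (x - a) ^ 2 ∂gaussianReal a v = v := by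
  have h := variance_fun_id_gaussianReal (μ := a) (v := v)
  rwa [variance_eq_integral (by fun_prop), integral_id_gaussianReal] at h

theorem exceedsByAtMost_gaussianReal (a b : ℝ) {v : ℝ≥0} (hv : v ≠ 0) (hab : |a - b| ≤ 1) :
    ExceedsByAtMost (gaussianReal a v) (gaussianReal b v)
      (ENNReal.ofReal (|a - b| * ((2 + v) / v))) := by
  intro A hA
  set g : ℝ → ℝ := fun x => |a - b| * ((2 + (x - a) ^ 2) / v) with hg
  have hg0 : ∀ x, 0 ≤ g x := fun x => by positivity
  have hgm : Measurable g := by fun_prop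
  have hgint : Integrable (fun x => (x - a) ^ 2) (gaussianReal a v) :=
    ((memLp_id_gaussianReal 2).sub (memLp_const a)).integrable_sq
  have hI : ∫⁻ x, ENNReal.ofReal (g x) ∂gaussianReal a v
      = ENNReal.ofReal (|a - b| * ((2 + v) / v)) := by
    rw [← ofReal_integral_eq_lintegral_ofReal _ (ae_of_all _ hg0)]
    · rw [hg, integral_const_mul, integral_div, integral_add (integrable_const _) hgint,
        integral_sq_sub_gaussianReal]
      simp
    · exact (((integrable_const _).add hgint).div_const _).const_mul _
  calc gaussianReal a v A = ∫⁻ x in A, gaussianPDF a v x := gaussianReal_apply a hv A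
    _ ≤ ∫⁻ x in A, (gaussianPDF b v x + gaussianPDF a v x * ENNReal.ofReal (g x)) := by
        refine lintegral_mono fun x => ?_
        rw [gaussianPDF, gaussianPDF, ← ENNReal.ofReal_mul (gaussianPDFReal_nonneg _ _ _),
          ← ENNReal.ofReal_add (gaussianPDFReal_nonneg _ _ _)
            (mul_nonneg (gaussianPDFReal_nonneg _ _ _) (hg0 x))]
        exact ENNReal.ofReal_le_ofReal (gaussianPDFReal_le_add a b hv hab x)
    _ = gaussianReal b v A + ∫⁻ x in A, gaussianPDF a v x * ENNReal.ofReal (g x) := by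
        rw [lintegral_add_left (measurable_gaussianPDF _ _), gaussianReal_apply b hv A]
    _ ≤ gaussianReal b v A + ∫⁻ x, gaussianPDF a v x * ENNReal.ofReal (g x) := by
        gcongr
        exact Measure.restrict_le_self
    _ = gaussianReal b v A + ENNReal.ofReal (|a - b| * ((2 + v) / v)) := by
        rw [← hI, gaussianReal_of_var_ne_zero a hv,
          lintegral_withDensity_eq_lintegral_mul _ (measurable_gaussianPDF _ _)
            hgm.ennreal_ofReal]
        rfl

/-! ### Events decided within finitely many rounds -/

variable {k : ℕ} {S : Type*} [MeasurableSpace S]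

/-- The seed together with the complete reward table of the first `n` rounds. -/
def firstRounds (k : ℕ) (S : Type*) (n : ℕ) (ω : SampleSpace k S) : S × (Fin n → Fin k → ℝ) :=
  (ω.1, fun t => ω.2 t)

theorem measurable_firstRounds (n : ℕ) : Measurable (firstRounds k S n) := by
  unfold firstRounds
  fun_prop

/-- What the forecaster has seen after `n` rounds is a function of the seed and of the reward table
of the first `n` rounds, whatever the sampling rule. -/
theorem history_le_comap_firstRounds (arm : ℕ → SampleSpace k S → Fin k)
    (h : ∀ t, Measurable[history arm t] (arm t)) (n : ℕ) :
    history arm n ≤ MeasurableSpace.comap (firstRounds k S n) inferInstance := by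
  induction n using Nat.strong_induction_on with
  | _ n ih =>
    have hφ : Measurable[MeasurableSpace.comap (firstRounds k S n) inferInstance]
        (firstRounds k S n) := comap_measurable _
    refine sup_le ?_ (iSup_le fun s => iSup_le fun hs => ?_)
    · exact (measurable_fst.comp hφ).comap_le
    · have hmono : MeasurableSpace.comap (firstRounds k S s) inferInstance ≤
          MeasurableSpace.comap (firstRounds k S n) inferInstance := by
        have hr : Measurable fun p : S × (Fin n → Fin k → ℝ) =>
            (p.1, fun t : Fin s => p.2 (t.castLE hs.le)) := by fun_prop
        exact (hr.comp hφ).comap_le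
      have hA : Measurable[MeasurableSpace.comap (firstRounds k S n) inferInstance] (arm s) :=
        (h s).mono ((ih s hs).trans hmono) le_rfl
      have hrow : Measurable[MeasurableSpace.comap (firstRounds k S n) inferInstance]
          fun ω : SampleSpace k S => ω.2 s :=
        ((measurable_pi_apply (⟨s, hs⟩ : Fin n)).comp measurable_snd).comp hφ
      have hev : Measurable fun p : Fin k × (Fin k → ℝ) => p.2 p.1 :=
        measurable_from_prod_countable_right fun i => measurable_pi_apply i
      exact (Measurable.prodMk hA (hev.comp (Measurable.prodMk hA hrow))).comap_le

theorem infinitePi_map_fin {X : Type*} [MeasurableSpace X] (ν : Measure X)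
    [IsProbabilityMeasure ν] (n : ℕ) :
    (Measure.infinitePi fun _ : ℕ => ν).map (fun x (t : Fin n) => x t) =
      Measure.pi fun _ : Fin n => ν := by
  refine (Measure.pi_eq fun s hs => ?_).symm
  rw [Measure.map_apply (by fun_prop) (MeasurableSet.univ_pi hs)]
  let s' : ℕ → Set X := fun t => if ht : t < n then s ⟨t, ht⟩ else Set.univ
  have hs' : ∀ t, MeasurableSet (s' t) := fun t => by
    unfold s'; split
    · exact hs _
    · exact MeasurableSet.univ
  have : (fun (x : ℕ → X) (t : Fin n) => x t) ⁻¹' Set.univ.pi s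
      = Set.pi (Finset.range n : Set ℕ) s' := by
    ext x
    simp only [Set.mem_preimage, Set.mem_pi, Set.mem_univ, true_imp_iff, Finset.coe_range,
      Set.mem_Iio]
    constructor
    · intro hx t ht
      simpa [s', ht] using hx ⟨t, ht⟩
    · intro hx t
      simpa [s', t.2] using hx t t.2
  rw [this, Measure.infinitePi_pi _ fun t _ => hs' t, Finset.prod_range]
  exact Finset.prod_congr rfl fun t _ => by simp [s']

theorem banditLaw_map_firstRounds (ρ : Measure S) [IsProbabilityMeasure ρ] (σ : Fin k → ℝ≥0)
    (μ : Fin k → ℝ) (n : ℕ) :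
    (banditLaw ρ σ μ).map (firstRounds k S n) =
      ρ.prod (Measure.pi fun _ : Fin n =>
        Measure.pi fun i : Fin k => gaussianReal (μ i) (σ i ^ 2)) := by
  have h := Measure.map_prod_map ρ (Measure.infinitePi fun _ : ℕ =>
    Measure.pi fun i : Fin k => gaussianReal (μ i) (σ i ^ 2)) measurable_id
      (g := fun x (t : Fin n) => x t) (by fun_prop)
  rw [Measure.map_id, infinitePi_map_fin] at h
  exact h.symm

instance (ρ : Measure S) [IsProbabilityMeasure ρ] (σ : Fin k → ℝ≥0) (μ : Fin k → ℝ) :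
    IsProbabilityMeasure (banditLaw ρ σ μ) := by
  unfold banditLaw
  infer_instance

/-- If the mean of one arm is moved by at most `1`, then the probability of an event that is
decided within `n` rounds changes by at most a constant times `n` times the displacement. -/
theorem banditLaw_le_add_of_history (ρ : Measure S) [IsProbabilityMeasure ρ] (σ : Fin k → ℝ≥0)
    (μ : Fin k → ℝ) (i : Fin k) (hσ : 0 < σ i) (b : ℝ) (hb : |μ i - b| ≤ 1)
    (arm : ℕ → SampleSpace k S → Fin k) (h : ∀ t, Measurable[history arm t] (arm t)) (n : ℕ)
    {E : Set (SampleSpace k S)} (hE : MeasurableSet[history arm n] E) :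
    banditLaw ρ σ μ E ≤ banditLaw ρ σ (Function.update μ i b) E +
      n * ENNReal.ofReal (|μ i - b| * ((2 + σ i ^ 2) / σ i ^ 2)) := by
  refine ExceedsByAtMost.of_map (measurable_firstRounds n) ?_
    (history_le_comap_firstRounds arm h n _ hE)
  rw [banditLaw_map_firstRounds, banditLaw_map_firstRounds]
  set d := ENNReal.ofReal (|μ i - b| * ((2 + σ i ^ 2) / σ i ^ 2)) with hd
  have hrow : ExceedsByAtMost (Measure.pi fun j : Fin k => gaussianReal (μ j) (σ j ^ 2))
      (Measure.pi fun j : Fin k => gaussianReal (Function.update μ i b j) (σ j ^ 2)) d := by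
    have := ExceedsByAtMost.pi (μ := fun j : Fin k => gaussianReal (μ j) (σ j ^ 2))
      (ν := fun j : Fin k => gaussianReal (Function.update μ i b j) (σ j ^ 2))
      (d := fun j => if j = i then d else 0) fun j => by
        by_cases hj : j = i
        · subst hj
          have := exceedsByAtMost_gaussianReal (μ j) b (v := σ j ^ 2) (by positivity) hb
          simpa [hd] using this
        · simpa [hj] using ExceedsByAtMost.refl _ _
    simpa using this
  have := (ExceedsByAtMost.refl ρ 0).prod (ExceedsByAtMost.pi fun _ : Fin n => hrow)
  simpa using this

/-! ### Lower bound for the expected stopping time -/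

/-- If arm `i` is the unique best arm of `μ` and `j` is another arm, a `δ`-correct algorithm has not
stopped after `n` rounds with a probability that is bounded below as long as `n` times the gap
`μ i - μ j` is small and `δ < 1 / 2`. The alternative instance is `μ` with the mean of arm `j`
reflected about that of arm `i`. -/
theorem Algorithm.one_le_add_measure_lt_τ (π : Algorithm k S) (ρ : Measure S)
    [IsProbabilityMeasure ρ] (σ : Fin k → ℝ≥0) {δ : ℝ} (hπ : π.IsDeltaCorrect ρ σ δ)
    (μ : Fin k → ℝ) {i j : Fin k} (hσ : 0 < σ j) (hij : j ≠ i) (hi : IsUniqueBest μ i)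
    (hgap : μ i - μ j ≤ 1 / 2) (n : ℕ) :
    1 ≤ ENNReal.ofReal δ + ENNReal.ofReal δ +
      n * ENNReal.ofReal (2 * (μ i - μ j) * ((2 + σ j ^ 2) / σ j ^ 2)) +
      banditLaw ρ σ μ {ω | (n : ℕ∞) < π.τ ω} := by
  set b : ℝ := 2 * μ i - μ j with hb
  set E : Set (SampleSpace k S) := {ω | π.J ω = i} ∩ {ω | π.τ ω ≤ n} with hE
  have hlt := hi j hij
  have habs : |μ j - b| = 2 * (μ i - μ j) := by
    rw [abs_of_nonpos (by linarith)]; linarith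
  have hEm : MeasurableSet[history π.arm n] E :=
    (π.measurable_J (measurableSet_singleton i)).2 n
  have hchange := banditLaw_le_add_of_history ρ σ μ j hσ b (by linarith) π.arm
    π.measurable_arm n hEm
  rw [habs] at hchange
  have hbest : IsUniqueBest (Function.update μ j b) j := by
    intro l hl
    rw [Function.update_self, Function.update_of_ne hl]
    rcases eq_or_ne l i with rfl | hli
    · linarith
    · linarith [hi l hli]
  have halt : banditLaw ρ σ (Function.update μ j b) E ≤ ENNReal.ofReal δ := by
    refine (measure_mono ?_).trans (hπ _ j hbest)
    rintro ω ⟨hω, -⟩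
    rw [Set.mem_ofPred_eq] at hω ⊢
    rw [hω]
    exact hij.symm
  have hcover : (Set.univ : Set (SampleSpace k S)) ⊆
      {ω | π.J ω ≠ i} ∪ E ∪ {ω | (n : ℕ∞) < π.τ ω} := by
    intro ω _
    by_cases h1 : π.J ω = i
    · rcases le_or_gt (π.τ ω) n with h2 | h2
      · exact Or.inl (Or.inr ⟨h1, h2⟩)
      · exact Or.inr h2
    · exact Or.inl (Or.inl h1)
  calc (1 : ℝ≥0∞) = banditLaw ρ σ μ Set.univ := measure_univ.symm
    _ ≤ banditLaw ρ σ μ {ω | π.J ω ≠ i} + banditLaw ρ σ μ E +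
          banditLaw ρ σ μ {ω | (n : ℕ∞) < π.τ ω} :=
        (measure_mono hcover).trans ((measure_union_le _ _).trans
          (add_le_add_left (measure_union_le _ _) _))
    _ ≤ _ := by
        rw [add_assoc (ENNReal.ofReal δ) (ENNReal.ofReal δ)]
        gcongr
        · exact hπ μ i hi
        · exact hchange.trans (add_le_add_left halt _)

theorem Algorithm.measurable_τ (π : Algorithm k S) : Measurable π.τ :=
   ENat.measurable_iff.2 fun n => history_le π.arm π.measurable_arm n _
    (π.isStoppingTime.measurableSet_eq n)

/-- The expected stopping time on an instance with best arm `i` is at least a constant times the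
inverse of the gap between `i` and `j`, with a constant that does not depend on the instance. -/
theorem Algorithm.div_gap_le_expectedTime (π : Algorithm k S) (ρ : Measure S)
    [IsProbabilityMeasure ρ] (σ : Fin k → ℝ≥0) {δ : ℝ} (hδ : 0 < δ) (hδ' : δ < 1 / 2)
    (hπ : π.IsDeltaCorrect ρ σ δ) {i j : Fin k} (hσ : 0 < σ j) (hij : j ≠ i) :
    ∃ c : ℝ, 0 < c ∧ ∀ μ : Fin k → ℝ, IsUniqueBest μ i → μ i - μ j ≤ 1 / 2 →
      ENNReal.ofReal (c * (μ i - μ j)⁻¹) ≤ π.expectedTime ρ σ μ := by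
  set C : ℝ := (2 + σ j ^ 2) / σ j ^ 2 with hC
  have hσ' : (0 : ℝ) < σ j := hσ
  have hC0 : 0 < C := by positivity
  set η : ℝ := (1 - 2 * δ) / 2 with hη
  have hη0 : 0 < η := by rw [hη]; linarith
  refine ⟨η / (2 * C) * η, by positivity, fun μ hi hgap => ?_⟩
  have hpos : 0 < μ i - μ j := sub_pos.2 (hi j hij)
  -- the largest horizon within which the two instances are hard to tell apart
  set n : ℕ := ⌊η / (2 * C) * (μ i - μ j)⁻¹⌋₊ with hn
  have hn1 : (n : ℝ) ≤ η / (2 * C) * (μ i - μ j)⁻¹ := Nat.floor_le (by positivity)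
  have hn2 : η / (2 * C) * (μ i - μ j)⁻¹ ≤ n + 1 := (Nat.lt_floor_add_one _).le
  have hnC : n * (2 * (μ i - μ j) * C) ≤ η := by
    calc n * (2 * (μ i - μ j) * C)
        ≤ η / (2 * C) * (μ i - μ j)⁻¹ * (2 * (μ i - μ j) * C) := by gcongr
      _ = η := by field_simp
  have hprob : ENNReal.ofReal η ≤ banditLaw ρ σ μ {ω | (n : ℕ∞) < π.τ ω} := by
    have h := π.one_le_add_measure_lt_τ ρ σ hπ μ hσ hij hi hgap n
    rw [← ENNReal.ofReal_natCast n, ← ENNReal.ofReal_mul (by positivity),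
      ← ENNReal.ofReal_add hδ.le hδ.le, ← ENNReal.ofReal_add (by positivity) (by positivity),
      ← ENNReal.ofReal_toReal (measure_ne_top (banditLaw ρ σ μ) _),
      ← ENNReal.ofReal_add (by positivity) ENNReal.toReal_nonneg, ENNReal.one_le_ofReal] at h
    refine (ENNReal.ofReal_le_iff_le_toReal (measure_ne_top _ _)).2 ?_
    have : 2 * η = 1 - 2 * δ := by rw [hη]; ring
    linarith
  have hm : Measurable fun ω => (π.τ ω : ℝ≥0∞) := by
    have : Measurable fun x : ℕ∞ => (x : ℝ≥0∞) := measurable_of_countable _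
    exact this.comp π.measurable_τ
  calc ENNReal.ofReal (η / (2 * C) * η * (μ i - μ j)⁻¹)
      ≤ ENNReal.ofReal ((n + 1) * η) := by
        refine ENNReal.ofReal_le_ofReal ?_
        rw [mul_right_comm]
        gcongr
    _ = ((n + 1 : ℕ) : ℝ≥0∞) * ENNReal.ofReal η := by
        rw [ENNReal.ofReal_mul (by positivity), ← ENNReal.ofReal_natCast]
        push_cast
        rfl
    _ ≤ ((n + 1 : ℕ) : ℝ≥0∞) * banditLaw ρ σ μ {ω | ((n + 1 : ℕ) : ℝ≥0∞) ≤ (π.τ ω : ℝ≥0∞)} := by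
        gcongr
        refine hprob.trans (measure_mono fun ω hω => ?_)
        have h1 : ((n + 1 : ℕ) : ℕ∞) ≤ π.τ ω := by
          push_cast
          exact Order.add_one_le_of_lt hω
        have h2 := ENat.toENNReal_le.2 h1
        simpa using h2
    _ ≤ ∫⁻ ω, (π.τ ω : ℝ≥0∞) ∂banditLaw ρ σ μ := mul_meas_ge_le_lintegral hm _

/-! ### Divergence of the prior integral -/

theorem gaussianReal_pos_of_isOpen (a : ℝ) {v : ℝ≥0} (hv : v ≠ 0) {s : Set ℝ} (hs : IsOpen s)
    (hne : s.Nonempty) : 0 < gaussianReal a v s := by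
  have hac := gaussianReal_absolutelyContinuous' a hv
  exact pos_iff_ne_zero.2 fun h => (hs.measure_pos volume hne).ne' (hac h)

/-- The inverse distance to a point `y` is not integrable to the right of `y` with respect to a
Gaussian. -/
theorem setLIntegral_inv_sub_gaussianReal (a : ℝ) {v : ℝ≥0} (hv : v ≠ 0) (y : ℝ) {c r : ℝ}
    (hc : 0 < c) (hr : 0 < r) :
    ∫⁻ x in Set.Ioc y (y + r), ENNReal.ofReal (c * (x - y)⁻¹) ∂gaussianReal a v = ∞ := by
  -- a lower bound for the density on the interval
  obtain ⟨x₀, -, hx₀⟩ := isCompact_Icc.exists_isMinOn (Set.nonempty_Icc.2 (by linarith : y ≤ y + r))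
    (f := gaussianPDFReal a v) (by unfold gaussianPDFReal; fun_prop)
  set p := gaussianPDFReal a v x₀ with hp
  have hp0 : 0 < p := gaussianPDFReal_pos a v x₀ hv
  have hdiv : ∫⁻ x in Set.Ioc y (y + r), ENNReal.ofReal ((x - y)⁻¹) = ∞ := by
    by_contra h
    have hint : IntervalIntegrable (fun x => (x - y)⁻¹) volume y (y + r) := by
      rw [intervalIntegrable_iff_integrableOn_Ioc_of_le (by linarith)]
      refine ⟨by fun_prop, ?_⟩
      rw [hasFiniteIntegral_iff_ofReal]
      · exact lt_top_iff_ne_top.2 h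
      · filter_upwards [ae_restrict_mem measurableSet_Ioc] with x hx
        exact inv_nonneg.2 (sub_nonneg.2 hx.1.le)
    rcases intervalIntegrable_sub_inv_iff.1 hint with h' | h'
    · linarith
    · exact h' Set.left_mem_uIcc
  rw [gaussianReal_of_var_ne_zero _ hv,
    setLIntegral_withDensity_eq_setLIntegral_mul _ (measurable_gaussianPDF _ _) (by fun_prop)
      measurableSet_Ioc, eq_top_iff]
  calc ∞ = ENNReal.ofReal (p * c) * ∫⁻ x in Set.Ioc y (y + r), ENNReal.ofReal ((x - y)⁻¹) := by
        rw [hdiv, ENNReal.mul_top (ENNReal.ofReal_pos.2 (by positivity)).ne']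
    _ = ∫⁻ x in Set.Ioc y (y + r), ENNReal.ofReal (p * c) * ENNReal.ofReal ((x - y)⁻¹) :=
        (lintegral_const_mul _ (by fun_prop)).symm
    _ ≤ _ := by
        refine setLIntegral_mono' measurableSet_Ioc fun x hx => ?_
        rw [Pi.mul_apply, gaussianPDF, ENNReal.ofReal_mul hp0.le, ENNReal.ofReal_mul hc.le,
          mul_assoc]
        gcongr
        exact hx₀ (Set.Ioc_subset_Icc_self hx)

/-- Tonelli's theorem with the `i`-th coordinate integrated first. -/
theorem lintegral_pi_eq_lintegral_update {ι : Type*} [Fintype ι] [DecidableEq ι] {X : ι → Type*}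
    [∀ i, MeasurableSpace (X i)] (ν : ∀ i, Measure (X i)) [∀ i, IsProbabilityMeasure (ν i)]
    {f : (∀ i, X i) → ℝ≥0∞} (hf : Measurable f) (i : ι) :
    ∫⁻ x, f x ∂Measure.pi ν = ∫⁻ x, ∫⁻ y, f (Function.update x i y) ∂ν i ∂Measure.pi ν := by
  have hg : Measurable (∫⋯∫⁻_{i}, f ∂ν) := hf.lmarginal ν
  rw [lmarginal_singleton] at hg
  refine lintegral_eq_of_lmarginal_eq {i} hf hg ?_
  rw [lmarginal_singleton, lmarginal_singleton]
  ext x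
  simp

/-- The inverse of the gap between arms `i` and `j` has infinite integral under a Gaussian prior,
even over the instances on which `i` is the unique best arm by a gap of at most `1 / 2`
over `j`. -/
theorem lintegral_inv_gap_gaussianPrior {k : ℕ} (m : Fin k → ℝ) (ξ : Fin k → ℝ≥0)
    (hξ : ∀ i, 0 < ξ i) {i j : Fin k} (hij : j ≠ i) {c : ℝ} (hc : 0 < c) :
    ∫⁻ μ, {μ | IsUniqueBest μ i ∧ μ i - μ j ≤ 1 / 2}.indicator
      (fun μ => ENNReal.ofReal (c * (μ i - μ j)⁻¹)) μ ∂gaussianPrior m ξ = ∞ := by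
  have hv : ∀ l, ξ l ^ 2 ≠ 0 := fun l => pow_ne_zero 2 (hξ l).ne'
  set G : Set (Fin k → ℝ) := {μ | IsUniqueBest μ i ∧ μ i - μ j ≤ 1 / 2} with hG
  have hGm : MeasurableSet G := by
    have : G = (⋂ l, ⋂ _ : l ≠ i, {μ : Fin k → ℝ | μ l < μ i}) ∩ {μ | μ i - μ j ≤ 1 / 2} := by
      ext μ; simp [hG, IsUniqueBest]
    rw [this]
    refine MeasurableSet.inter (MeasurableSet.iInter fun l => MeasurableSet.iInter fun _ => ?_) ?_
    · exact measurableSet_lt (by fun_prop) (by fun_prop)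
    · exact measurableSet_le (by fun_prop) (by fun_prop)
  -- in this box, `j` is the best arm apart from `i`
  set B : Set (Fin k → ℝ) := Set.univ.pi fun l => if l = j then Set.Ioi 0 else Set.Iio 0 with hB
  have hBpos : 0 < gaussianPrior m ξ B := by
    rw [gaussianPrior, hB, Measure.pi_pi, pos_iff_ne_zero (α := ℝ≥0∞), Finset.prod_ne_zero_iff]
    intro l _
    refine (gaussianReal_pos_of_isOpen _ (hv l) ?_ ?_).ne' <;> split
    exacts [isOpen_Ioi, isOpen_Iio, Set.nonempty_Ioi, Set.nonempty_Iio]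
  have hBm : MeasurableSet B := MeasurableSet.univ_pi fun l => by
    split
    exacts [measurableSet_Ioi, measurableSet_Iio]
  rw [gaussianPrior,
    lintegral_pi_eq_lintegral_update _ (Measurable.indicator (by fun_prop) hGm) i, eq_top_iff]
  calc (∞ : ℝ≥0∞) = ∞ * gaussianPrior m ξ B := (ENNReal.top_mul hBpos.ne').symm
    _ = ∫⁻ _ in B, ∞ ∂gaussianPrior m ξ := (setLIntegral_const _ _).symm
    _ ≤ ∫⁻ μ in B, ∫⁻ x, G.indicator (fun μ => ENNReal.ofReal (c * (μ i - μ j)⁻¹))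
          (Function.update μ i x) ∂gaussianReal (m i) (ξ i ^ 2) ∂gaussianPrior m ξ := by
        refine setLIntegral_mono' hBm fun μ hμ => ?_
        rw [← setLIntegral_inv_sub_gaussianReal (m i) (hv i) (μ j) hc (one_half_pos (α := ℝ)),
          ← lintegral_indicator measurableSet_Ioc]
        refine lintegral_mono (Set.indicator_le fun x hx => ?_)
        have hμj : 0 < μ j := by simpa using hμ j trivial
        have hmem : Function.update μ i x ∈ G := by
          refine ⟨fun l hl => ?_, ?_⟩
          · rw [Function.update_self, Function.update_of_ne hl]
            rcases eq_or_ne l j with rfl | hlj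
            · exact hx.1
            · have hμl : μ l < 0 := by simpa [hlj] using hμ l trivial
              linarith [hx.1]
          · rw [Function.update_self, Function.update_of_ne hij]
            linarith [hx.2]
        rw [Set.indicator_of_mem hmem, Function.update_self, Function.update_of_ne hij]
    _ ≤ _ := setLIntegral_le_lintegral _ _

end GaussianBandit

theorem mainTheorem1 {k : ℕ} (hk : 2 ≤ k)
    {S : Type*} [MeasurableSpace S] (ρ : Measure S) [IsProbabilityMeasure ρ]
    (σ : Fin k → ℝ≥0) (hσ : ∀ i, 0 < σ i)
    (m : Fin k → ℝ) (ξ : Fin k → ℝ≥0) (hξ : ∀ i, 0 < ξ i)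
    (δ : ℝ) (hδ_pos : 0 < δ) (hδ_lt : δ < 1 / 2)
    (π : GaussianBandit.Algorithm k S) (hπ : π.IsDeltaCorrect ρ σ δ) :
    π.bayesExpectedTime ρ σ (GaussianBandit.gaussianPrior m ξ) = ⊤ := by
  have hij : (⟨1, by omega⟩ : Fin k) ≠ ⟨0, by omega⟩ := by simp
  obtain ⟨c, hc, hle⟩ := π.div_gap_le_expectedTime ρ σ hδ_pos hδ_lt hπ (hσ _) hij
  rw [eq_top_iff, ← GaussianBandit.lintegral_inv_gap_gaussianPrior m ξ hξ hij hc]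
  exact lintegral_mono fun μ => Set.indicator_le (fun μ hμ => hle μ hμ.1 hμ.2) μ
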